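/- **Theorem.** Let $\Lambda$ be a finite linearly ordered set and let $(x_k)_{k\ge 0}$ be a Markov chain on $\Lambda$ with transition probabilities $p_{t,s}$ that is ergodic, in the sense that its transition matrix is irreducible (aperiodicity is not required), and that is started from its stationary distribution $\pi$. For a finite sequence $a=(a_0,\dots,a_n)$ in $\Lambda$, a subsequence $(a_{\ell_1},\dots,a_{\ell_m})$ with $\ell_1<\dots<\ell_m$ is called alternating if $a_{\ell_1}>a_{\ell_2}<a_{\ell_3}>\cdots$ (strict inequalities, alternating in direction, the first being $>$; every subsequence of length $1$ is alternating). Let $\mathrm{LA}_n(x_0,\dots,x_n)$ be the length of the longest alternating subsequence of the first $n+1$ elements $(x_0,\dots,x_n)$ of the chain, and put $$\mathrm{Osc}(x)=\sum_{t<s>r}\frac{\pi_t\,p_{t,s}\,p_{s,r}}{1-p_{s,s}}+\sum_{t>s<r}\frac{\pi_t\,p_{t,s}\,p_{s,r}}{1-p_{s,s}},$$ where the first sum is over all $t,s,r\in\Lambda$ with $t<s$ and $r<s$, and the second over all $t,s,r\in\Lambda$ with $t>s$ and $r>s$. Then, as $n\to\infty$, $$\frac{\mathrm{LA}_n(x_0,\dots,x_n)}{n}\longrightarrow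 \mathrm{Osc}(x)$$ almost surely and in the mean, that is, also $\mathbf E\left|\mathrm{LA}_n(x_0,\dots,x_n)/n-\mathrm{Osc}(x)\right|\to 0$. -/

import Mathlib

open Filter Topology MeasureTheory

noncomputable section

namespace AlternatingSubsequence

variable {Λ : Type*} [LinearOrder Λ]

/-- The finite sequence `b` satisfies `b 0 > b 1 < b 2 > b 3 < ⋯`. -/
def IsAlternating {m : ℕ} (b : Fin m → Λ) : Prop :=
  ∀ (i : ℕ) (hi : i + 1 < m),
    (Even i → b ⟨i + 1, hi⟩ < b ⟨i, by omega⟩) ∧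
    (Odd i → b ⟨i, by omega⟩ < b ⟨i + 1, hi⟩)

/-- The sequence `a` has an alternating subsequence of length `m`. -/
def HasAlternating {N : ℕ} (a : Fin N → Λ) (m : ℕ) : Prop :=
  ∃ l : Fin m → Fin N, StrictMono l ∧ IsAlternating (a ∘ l)

/-- The length of the longest alternating subsequence of the finite sequence `a`. -/
def LA {N : ℕ} (a : Fin N → Λ) : ℕ :=
  sSup {m : ℕ | HasAlternating a m}

/-- The supremum defining `LA` is attained, so `LA` is a maximum. -/
theorem isGreatest_LA {N : ℕ} (a : Fin N → Λ) :
    IsGreatest {m : ℕ | HasAlternating a m} (LA a) := by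
  have hb : BddAbove {m : ℕ | HasAlternating a m} := by
    refine ⟨N, ?_⟩
    rintro m ⟨l, hl, -⟩
    simpa using Fintype.card_le_of_injective l hl.injective
  have hne : {m : ℕ | HasAlternating a m}.Nonempty :=
    ⟨0, Fin.elim0, fun i => i.elim0, fun i hi => by omega⟩
  exact ⟨Nat.sSup_mem hne hb, fun m hm => le_csSup hb hm⟩

/-- The process `X` is a Markov chain under `μ`, with initial distribution `π` and transition
matrix `P`: the entries `P i j` are transition probabilities, and a path `a 0, …, a n` has
probability `π (a 0) * P (a 0) (a 1) * ⋯ * P (a (n - 1)) (a n)`. -/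
structure IsMarkovChain [Fintype Λ] [MeasurableSpace Λ] {Ω : Type*} [MeasurableSpace Ω]
    (μ : Measure Ω) (X : ℕ → Ω → Λ) (π : Λ → ℝ) (P : Matrix Λ Λ ℝ) : Prop where
  stochastic : P ∈ Matrix.rowStochastic ℝ Λ
  initial : π ∈ stdSimplex ℝ Λ
  measurable : ∀ k, Measurable (X k)
  path_prob : ∀ (n : ℕ) (a : Fin (n + 1) → Λ),
    μ.real {ω | ∀ k : Fin (n + 1), X k ω = a k} =
      π (a 0) * ∏ k : Fin n, P (a k.castSucc) (a k.succ)

/-- `∑_{t < s > r} π_t p_{ts} p_{sr} / (1 - p_{ss})`. -/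
def oscPlus [Fintype Λ] (π : Λ → ℝ) (P : Matrix Λ Λ ℝ) : ℝ :=
  ∑ s, ∑ t with t < s, ∑ r with r < s, π t * P t s * P s r / (1 - P s s)

/-- `∑_{t > s < r} π_t p_{ts} p_{sr} / (1 - p_{ss})`. -/
def oscMinus [Fintype Λ] (π : Λ → ℝ) (P : Matrix Λ Λ ℝ) : ℝ :=
  ∑ s, ∑ t with s < t, ∑ r with s < r, π t * P t s * P s r / (1 - P s s)

/-- The oscillation of a Markov chain with stationary distribution `π` and transition
matrix `P`. -/
def Osc [Fintype Λ] (π : Λ → ℝ) (P : Matrix Λ Λ ℝ) : ℝ :=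
  oscPlus π P + oscMinus π P

end AlternatingSubsequence

end

/-! A greedy choice is optimal: the longest alternating subsequence has one more term than the
number of direction changes (`LA_eq_turnCount_add_one`), so a law of large numbers for `turnCount`
is needed.

The count is not a function of the chain alone, since the awaited direction matters. Adding
`turnProb`, the chance that the next strict move is a turn, removes this memory: the one-step mean
gain becomes `drift`, a function of the state only (`sum_turn_add_turnProb`), whose stationary mean
is `Osc`. A solution of the Poisson equation absorbs the fluctuation of `drift`, so the count plus a
bounded corrector, minus `n * Osc`, is a martingale with bounded increments.

Its second moment thus grows linearly. This gives almost sure convergence along squares,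
monotonicity of the count fills the gaps, and boundedness of the quotients gives convergence in
mean. -/

namespace AlternatingSubsequence

/-! ### Greedy description of the longest alternating subsequence. -/

section Combinatorics

variable {Λ : Type*} [LinearOrder Λ]

/-- With `c` direction changes so far, the next change is a descent if `c` is even and an ascent
if `c` is odd. `turn c t s` is `1` if the move from `t` to `s` is such a change, else `0`. -/
def turn (c : ℕ) (t s : Λ) : ℕ :=
  if Even c then (if s < t then 1 else 0) else (if t < s then 1 else 0)

/-- The number of direction changes of `x 0, …, x n`, where the initial direction is upward. -/
def turnCount (x : ℕ → Λ) : ℕ → ℕ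
  | 0 => 0
  | n + 1 => turnCount x n + turn (turnCount x n) (x n) (x (n + 1))

theorem turn_le_one (c : ℕ) (t s : Λ) : turn c t s ≤ 1 := by
  unfold turn; split_ifs <;> simp

theorem turnCount_succ (x : ℕ → Λ) (n : ℕ) :
    turnCount x (n + 1) = turnCount x n + turn (turnCount x n) (x n) (x (n + 1)) := rfl

theorem turnCount_mono (x : ℕ → Λ) : Monotone (turnCount x) :=
  monotone_nat_of_le_succ fun _ => Nat.le_add_right _ _

theorem turnCount_le (x : ℕ → Λ) (n : ℕ) : turnCount x n ≤ n := by
  induction n with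
  | zero => exact le_rfl
  | succ n ih => exact Nat.add_le_add ih (turn_le_one _ _ _)

theorem turnCount_congr {x y : ℕ → Λ} {n : ℕ} (h : ∀ k ≤ n, x k = y k) :
    turnCount x n = turnCount y n := by
  induction n with
  | zero => rfl
  | succ n ih =>
    rw [turnCount_succ, turnCount_succ, ih fun k hk => h k (by omega), h n (by omega),
      h (n + 1) le_rfl]

/-- Between two direction changes the sequence is monotone. -/
theorem monotone_of_turnCount_eq (x : ℕ → Λ) {j k : ℕ} (hjk : j ≤ k)
    (h : turnCount x k = turnCount x j) :
    (Even (turnCount x j) → x j ≤ x k) ∧ (¬ Even (turnCount x j) → x k ≤ x j) := by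
  induction k, hjk using Nat.le_induction with
  | base => simp
  | succ k hjk ih =>
    have h1 := turnCount_mono x hjk
    have h2 := turnCount_mono x k.le_succ
    have hk : turnCount x k = turnCount x j := by simp only [Nat.succ_eq_add_one] at h2; omega
    have ht : turn (turnCount x j) (x k) (x (k + 1)) = 0 := by
      rw [turnCount_succ, hk] at h; omega
    refine ⟨fun he => ((ih hk).1 he).trans ?_, fun he => le_trans ?_ ((ih hk).2 he)⟩ <;>
    · by_contra! hlt
      simp [turn, he, hlt] at ht

/-- Without a turn between two consecutive chosen indices, the sequence would be monotone there,
against the strict step required. -/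
theorem le_turnCount_of_alternating (x : ℕ → Λ) {m : ℕ} (l : Fin m → ℕ) (hl : StrictMono l)
    (ha : IsAlternating (x ∘ l)) (i : ℕ) (hi : i < m) : i ≤ turnCount x (l ⟨i, hi⟩) := by
  induction i with
  | zero => exact Nat.zero_le _
  | succ i ih =>
    have ih := ih (by omega)
    have hlt : l ⟨i, by omega⟩ < l ⟨i + 1, hi⟩ := hl (by simp)
    have hmono := turnCount_mono x hlt.le
    by_contra hcon
    have h1 : turnCount x (l ⟨i, by omega⟩) = i := by omega
    have h2 := monotone_of_turnCount_eq x hlt.le (by omega)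
    rw [h1] at h2
    obtain ⟨he, ho⟩ := ha i hi
    by_cases hev : Even i
    · exact absurd (he hev) (not_lt.mpr (h2.1 hev))
    · exact absurd (ho (Nat.not_even_iff_odd.mp hev)) (not_lt.mpr (h2.2 hev))

theorem exists_alternating_turnCount (x : ℕ → Λ) (n : ℕ) :
    ∃ l : ℕ → ℕ, l (turnCount x n) = n ∧
      ∀ i < turnCount x n, l i < l (i + 1) ∧
        (Even i → x (l (i + 1)) < x (l i)) ∧ (¬ Even i → x (l i) < x (l (i + 1))) := by
  induction n with
  | zero => exact ⟨fun _ => 0, rfl, fun i hi => by simp [turnCount] at hi⟩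
  | succ n ih =>
    obtain ⟨l, hln, hl⟩ := ih
    -- The last chosen index is always the current time. A turn appends `n + 1`; otherwise `n + 1`
    -- replaces the last index `n`, which keeps the last comparison strict.
    refine ⟨Function.update l (turnCount x (n + 1)) (n + 1), by simp, fun i hi => ?_⟩
    rw [Function.update_of_ne hi.ne]
    by_cases hi' : i + 1 = turnCount x (n + 1)
    · rw [hi', Function.update_self]
      rw [turnCount_succ] at hi'
      rcases (Nat.le_one_iff_eq_zero_or_eq_one).mp
        (turn_le_one (turnCount x n) (x n) (x (n + 1))) with ht | ht
      · have hin : i + 1 = turnCount x n := by omega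
        obtain ⟨h1, h2, h3⟩ := hl i (by omega)
        rw [hin, hln] at h1 h2 h3
        refine ⟨by omega, fun he => lt_of_le_of_lt ?_ (h2 he), fun he => (h3 he).trans_le ?_⟩ <;>
        · by_contra! hlt
          rw [← hin] at ht
          simp [turn, he, hlt, Nat.even_add_one] at ht
      · have hin : i = turnCount x n := by omega
        subst hin
        rw [hln]
        refine ⟨by omega, fun he => ?_, fun he => ?_⟩ <;>
        · by_contra hlt
          simp [turn, he, hlt] at ht
    · rw [Function.update_of_ne hi']
      refine hl i ?_
      have := turn_le_one (turnCount x n) (x n) (x (n + 1))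
      rw [turnCount_succ] at hi hi'
      omega

theorem LA_eq_turnCount_add_one (x : ℕ → Λ) (n : ℕ) :
    LA (fun k : Fin (n + 1) => x k) = turnCount x n + 1 := by
  refine (isGreatest_LA _).unique ⟨?_, ?_⟩
  · obtain ⟨l, hln, hl⟩ := exists_alternating_turnCount x n
    have hmono : ∀ i j, i ≤ j → j ≤ turnCount x n → l i ≤ l j := by
      intro i j hij
      induction j, hij using Nat.le_induction with
      | base => exact fun _ => le_rfl
      | succ j _ ih => exact fun hj => (ih (by omega)).trans (hl j (by omega)).1.le
    have hle : ∀ i ≤ turnCount x n, l i < n + 1 := fun i hi =>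
      Nat.lt_succ_of_le (hln ▸ hmono i _ hi le_rfl)
    refine ⟨fun i => ⟨l i, hle i (by omega)⟩, fun i j hij => ?_, fun i hi => ?_⟩
    · have hij' : (i : ℕ) < j := hij
      exact (hl i (by omega)).1.trans_le (hmono _ _ (by omega) (by omega))
    · have := hl i (by omega)
      exact ⟨fun he => this.2.1 he, fun ho => this.2.2 (Nat.not_even_iff_odd.mpr ho)⟩
  · rintro m ⟨l, hl, ha⟩
    rcases Nat.eq_zero_or_pos m with rfl | hm
    · exact Nat.zero_le _
    · have h1 := le_turnCount_of_alternating x (fun i => (l i : ℕ)) (fun i j hij => hl hij) ha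
        (m - 1) (by omega)
      have h2 := turnCount_mono x (Nat.lt_succ_iff.mp (l ⟨m - 1, by omega⟩).isLt)
      omega

end Combinatorics

/-! ### Harmonic functions and the Poisson equation. -/

section Poisson

variable {ι : Type*} [Fintype ι] [DecidableEq ι]

/-- Harmonic functions of an irreducible stochastic matrix are constant. -/
theorem eq_of_mulVec_eq {P : Matrix ι ι ℝ} (hP : P ∈ Matrix.rowStochastic ℝ ι)
    (hirr : P.IsIrreducible) {f : ι → ℝ} (hf : P.mulVec f = f) (i j : ι) : f i = f j := by
  -- Maximum principle: `f m` is an average of values at most `f m`, under a power of `P` giving `k`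
  -- positive weight.
  obtain ⟨m, -, hm⟩ := Finset.exists_max_image Finset.univ f ⟨i, Finset.mem_univ i⟩
  suffices h : ∀ k, f k = f m by rw [h i, h j]
  intro k
  obtain ⟨N, -, hN⟩ := (Matrix.isIrreducible_iff_exists_pow_pos hirr.nonneg).mp hirr m k
  have hPN : P ^ N ∈ Matrix.rowStochastic ℝ ι := pow_mem hP N
  have hfN : (P ^ N).mulVec f = f := by
    clear hN hPN
    induction N with
    | zero => simp
    | succ N ih => rw [pow_succ, ← Matrix.mulVec_mulVec, hf, ih]
  have h0 : ∑ l, (P ^ N) m l * (f m - f l) = 0 := by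
    have := congrFun hfN m
    simp only [Matrix.mulVec, dotProduct] at this
    simp only [mul_sub, Finset.sum_sub_distrib, ← Finset.sum_mul,
      Matrix.sum_row_of_mem_rowStochastic hPN, this]
    ring
  have h1 := (Finset.sum_eq_zero_iff_of_nonneg fun l _ =>
    mul_nonneg (Matrix.nonneg_of_mem_rowStochastic hPN)
      (sub_nonneg.mpr (hm l (Finset.mem_univ l)))).mp h0 k (Finset.mem_univ k)
  rcases mul_eq_zero.mp h1 with h | h
  · exact absurd h hN.ne'
  · linarith

/-- Solvability of the Poisson equation of an irreducible finite Markov chain. -/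
theorem exists_poisson {P : Matrix ι ι ℝ} (hP : P ∈ Matrix.rowStochastic ℝ ι)
    (hirr : P.IsIrreducible) {π : ι → ℝ} (hπ : π ∈ stdSimplex ℝ ι)
    (hstat : Matrix.vecMul π P = π) {h : ι → ℝ} (hh : π ⬝ᵥ h = 0) :
    ∃ f : ι → ℝ, ∀ i, f i - ∑ j, P i j * f j = h i := by
  let T : (ι → ℝ) →ₗ[ℝ] (ι → ℝ) := LinearMap.id - P.mulVecLin
  let φ : (ι → ℝ) →ₗ[ℝ] ℝ := dotProductBilin ℝ ℝ π
  have hφ : φ ≠ 0 := fun h0 => by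
    have : φ 1 = 0 := by rw [h0]; rfl
    rw [show φ 1 = ∑ i, π i by simp [φ, dotProductBilin, dotProduct], hπ.2] at this
    exact one_ne_zero this
  have hle : LinearMap.range T ≤ LinearMap.ker φ := by
    rintro _ ⟨f, rfl⟩
    change π ⬝ᵥ (f - P.mulVec f) = 0
    rw [dotProduct_sub, Matrix.dotProduct_mulVec, hstat, sub_self]
  have hker : Module.finrank ℝ (LinearMap.ker T) ≤ 1 := by
    refine finrank_le_one_iff.mpr ?_
    refine ⟨⟨1, ?_⟩, fun ⟨w, hw⟩ => ?_⟩
    · change (1 : ι → ℝ) - P.mulVec 1 = 0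
      rw [Matrix.one_vecMul_of_mem_rowStochastic hP, sub_self]
    · have hw' : P.mulVec w = w := (sub_eq_zero.mp (show w - P.mulVec w = 0 from hw)).symm
      rcases isEmpty_or_nonempty ι with he | ⟨⟨i⟩⟩
      · exact ⟨0, Subsingleton.elim _ _⟩
      · refine ⟨w i, Subtype.ext (funext fun j => ?_)⟩
        simpa using eq_of_mulVec_eq hP hirr hw' i j
  -- Rank-nullity: the range of `T` has codimension at most 1 and lies in the hyperplane `ker φ`, so
  -- the two agree.
  have hr1 := T.finrank_range_add_finrank_ker
  have hr2 := φ.finrank_range_add_finrank_ker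
  have hr3 : Module.finrank ℝ (LinearMap.range φ) = 1 := by
    rw [LinearMap.range_eq_top.mpr (LinearMap.surjective hφ)]; simp
  have heq := Submodule.eq_of_le_of_finrank_le hle (by omega)
  obtain ⟨f, hf⟩ : h ∈ LinearMap.range T := by rw [heq]; exact hh
  exact ⟨f, fun i => congrFun hf i⟩

end Poisson

/-! ### The corrector. -/

section Corrector

variable {Λ : Type*} [LinearOrder Λ] [Fintype Λ]

/-- The probability that the next strict move from `s` is the change of direction expected after
`c` changes. -/
noncomputable def turnProb (P : Matrix Λ Λ ℝ) (c : ℕ) (s : Λ) : ℝ :=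
  (∑ r, P s r * turn c s r) / (1 - P s s)

theorem turnProb_mul {P : Matrix Λ Λ ℝ} (hP : P ∈ Matrix.rowStochastic ℝ Λ) (c : ℕ) (s : Λ) :
    turnProb P c s * (1 - P s s) = ∑ r, P s r * turn c s r := by
  -- If `P s s = 1`, the quotient is 0 by convention, and the right side vanishes too: no mass
  -- leaves `s`.
  refine div_mul_cancel_of_imp fun h => ?_
  have hsum := Matrix.sum_row_of_mem_rowStochastic hP s
  rw [← Finset.add_sum_erase _ _ (Finset.mem_univ s)] at hsum
  have h0 := (Finset.sum_eq_zero_iff_of_nonneg fun r _ =>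
    Matrix.nonneg_of_mem_rowStochastic hP).mp (show ∑ r ∈ Finset.univ.erase s, P s r = 0 by linarith)
  refine Finset.sum_eq_zero fun r _ => ?_
  by_cases hr : r = s
  · simp [hr, turn]
  · simp [h0 r (by simp [hr])]

theorem turnProb_congr (P : Matrix Λ Λ ℝ) (c d : ℕ) (h : Even c ↔ Even d) (s : Λ) :
    turnProb P c s = turnProb P d s := by
  simp [turnProb, turn, h]

/-- The expected turning probability after a strict move from `t`. -/
noncomputable def drift (P : Matrix Λ Λ ℝ) (t : Λ) : ℝ :=
  ∑ s, ((if t < s then P t s * turnProb P 0 s else 0)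
    + (if s < t then P t s * turnProb P 1 s else 0))

/-- A strict move determines the next awaited direction, whatever `c` was: descent after a rise,
ascent after a fall. Only the turn itself and the holding term depend on `c`, and together they give
back `turnProb P c t`. -/
theorem sum_turn_add_turnProb {P : Matrix Λ Λ ℝ} (hP : P ∈ Matrix.rowStochastic ℝ Λ)
    (c : ℕ) (t : Λ) :
    ∑ s, P t s * (turn c t s + turnProb P (c + turn c t s) s) = turnProb P c t + drift P t := by
  have key : ∀ s, P t s * (turn c t s + turnProb P (c + turn c t s) s) =
      P t s * turn c t s + ((if t < s then P t s * turnProb P 0 s else 0)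
        + (if s < t then P t s * turnProb P 1 s else 0))
        + (if s = t then P t t * turnProb P c t else 0) := by
    intro s
    rcases lt_trichotomy s t with h | rfl | h
    · rw [turnProb_congr P (c + turn c t s) 1]
      · simp [h, h.ne, h.not_gt, mul_add]
      · by_cases hc : Even c <;> simp [turn, h, h.not_gt, hc, Nat.even_add_one]
    · simp [turn]
    · rw [turnProb_congr P (c + turn c t s) 0]
      · simp [h, h.ne', h.not_gt, mul_add]
      · by_cases hc : Even c <;> simp [turn, h, h.not_gt, hc, Nat.even_add_one]
  rw [Finset.sum_congr rfl fun s _ => key s, Finset.sum_add_distrib, Finset.sum_add_distrib,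
    ← turnProb_mul hP c t, Finset.sum_ite_eq' Finset.univ t]
  simp only [Finset.mem_univ, if_true, drift]
  ring

theorem dotProduct_drift (π : Λ → ℝ) (P : Matrix Λ Λ ℝ) : π ⬝ᵥ drift P = Osc π P := by
  simp only [dotProduct, drift, Osc, oscPlus, oscMinus, Finset.mul_sum]
  rw [Finset.sum_comm, ← Finset.sum_add_distrib]
  refine Finset.sum_congr rfl fun s _ => ?_
  rw [Finset.sum_filter, Finset.sum_filter, ← Finset.sum_add_distrib]
  refine Finset.sum_congr rfl fun t _ => ?_
  rw [mul_add]
  congr 1 <;>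
  · split_ifs
    · simp [turnProb, turn, Finset.sum_filter, Finset.mul_sum, Finset.sum_div, mul_ite, ite_div,
        mul_assoc, mul_div_assoc]
    · simp

/-- A bounded function correcting the number of turns to a martingale. -/
theorem exists_corrector {π : Λ → ℝ} {P : Matrix Λ Λ ℝ} (hP : P ∈ Matrix.rowStochastic ℝ Λ)
    (hπ : π ∈ stdSimplex ℝ Λ) (hstat : Matrix.vecMul π P = π) (hirr : P.IsIrreducible) :
    ∃ (F : ℕ → Λ → ℝ) (B : ℝ), (∀ c s, |F c s| ≤ B) ∧ ∀ c t,
      ∑ s, P t s * (turn c t s + F (c + turn c t s) s) = F c t + Osc π P := by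
  obtain ⟨f, hf⟩ := exists_poisson hP hirr hπ hstat (h := fun t => drift P t - Osc π P) (by
    have : (fun t => drift P t - Osc π P) = drift P - Osc π P • (1 : Λ → ℝ) := by
      ext; simp
    rw [this, dotProduct_sub, dotProduct_drift, dotProduct_smul, dotProduct_one, hπ.2]
    simp)
  refine ⟨fun c s => turnProb P c s + f s,
    ∑ s, (|turnProb P 0 s| + |turnProb P 1 s| + |f s|), fun c s => ?_, fun c t => ?_⟩
  · have h1 : |turnProb P c s| ≤ |turnProb P 0 s| + |turnProb P 1 s| := by
      by_cases hc : Even c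
      · rw [turnProb_congr P c 0 (by simp [hc])]
        exact le_add_of_nonneg_right (abs_nonneg _)
      · rw [turnProb_congr P c 1 (by simp [hc])]
        exact le_add_of_nonneg_left (abs_nonneg _)
    have h2 := Finset.single_le_sum
      (f := fun s => |turnProb P 0 s| + |turnProb P 1 s| + |f s|)
      (fun s _ => by positivity) (Finset.mem_univ s)
    have h3 := abs_add_le (turnProb P c s) (f s)
    linarith
  · have h1 := sum_turn_add_turnProb hP c t
    have h2 := hf t
    simp only [← add_assoc, mul_add _ _ (f _), Finset.sum_add_distrib] at h1 ⊢
    linarith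

end Corrector

section Centered

variable {Λ : Type*} [LinearOrder Λ]

/-- The number of turns, centered and corrected by `F`. -/
noncomputable def centered (F : ℕ → Λ → ℝ) (c : ℝ) (x : ℕ → Λ) (n : ℕ) : ℝ :=
  turnCount x n + F (turnCount x n) (x n) - n * c

theorem centered_congr (F : ℕ → Λ → ℝ) (c : ℝ) {n : ℕ} {x y : ℕ → Λ}
    (h : ∀ k ≤ n, x k = y k) : centered F c x n = centered F c y n := by
  simp only [centered, turnCount_congr h, h n le_rfl]

end Centered

/-! ### Second moments by orthogonality of martingale increments. -/

section Moments

variable {Λ : Type*} [LinearOrder Λ] [Fintype Λ] [MeasurableSpace Λ] [MeasurableSingletonClass Λ]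
  {Ω : Type*} [MeasurableSpace Ω] {μ : Measure Ω}
  {X : ℕ → Ω → Λ} {π : Λ → ℝ} {P : Matrix Λ Λ ℝ}

theorem IsMarkovChain.measurable_of_dependsOn (hX : IsMarkovChain μ X π P) {β : Type*}
    [MeasurableSpace β] (n : ℕ) (G : (ℕ → Λ) → β)
    (hG : ∀ x y : ℕ → Λ, (∀ k ≤ n, x k = y k) → G x = G y) :
    Measurable fun ω => G fun k => X k ω := by
  have h : (fun ω => G fun k => X k ω) =
      -- Indices are read modulo `n + 1`; values beyond time `n` do not affect `G`.
      (fun a : Fin (n + 1) → Λ => G fun k => a (Fin.ofNat (n + 1) k)) ∘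
        fun ω (k : Fin (n + 1)) => X k ω := by
    ext ω
    refine hG _ _ fun k hk => ?_
    simp [Fin.ofNat, Nat.mod_eq_of_lt (Nat.lt_succ_of_le hk)]
  rw [h]
  exact (measurable_of_finite _).comp (measurable_pi_lambda _ fun k => hX.measurable k)

variable [IsProbabilityMeasure μ]

/-- A function of the present path and the next state whose one-step conditional mean vanishes
has mean zero. -/
theorem IsMarkovChain.integral_eq_zero (hX : IsMarkovChain μ X π P) (n : ℕ)
    (ψ : (Fin (n + 1) → Λ) → Λ → ℝ) (hψ : ∀ a, ∑ s, P (a (Fin.last n)) s * ψ a s = 0) :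
    ∫ ω, ψ (fun k : Fin (n + 1) => X k ω) (X (n + 1) ω) ∂μ = 0 := by
  have hZ : Measurable fun ω (k : Fin (n + 2)) => X k ω :=
    measurable_pi_lambda _ fun k => hX.measurable k
  have h1 : ∫ ω, ψ (fun k : Fin (n + 1) => X k ω) (X (n + 1) ω) ∂μ =
      ∫ a : Fin (n + 2) → Λ, ψ (Fin.init a) (a (Fin.last _))
        ∂(μ.map fun ω (k : Fin (n + 2)) => X k ω) := by
    rw [integral_map hZ.aemeasurable (measurable_of_finite _).aestronglyMeasurable]
    rfl
  have := Measure.isProbabilityMeasure_map (μ := μ) hZ.aemeasurable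
  rw [h1, integral_fintype Integrable.of_finite]
  have h2 : ∀ a : Fin (n + 2) → Λ, (μ.map fun ω (k : Fin (n + 2)) => X k ω).real {a} =
      π (a 0) * ∏ k : Fin (n + 1), P (a k.castSucc) (a k.succ) := by
    intro a
    rw [map_measureReal_apply hZ (measurableSet_singleton a), ← hX.path_prob (n + 1) a]
    congr 1
    ext ω
    simp [funext_iff]
  simp only [h2, smul_eq_mul]
  -- Split off the last state: the path weight factors, and the inner sum is the conditional mean.
  rw [← (Fin.snocEquiv fun _ : Fin (n + 2) => Λ).sum_comp, Fintype.sum_prod_type_right]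
  refine Finset.sum_eq_zero fun a _ => ?_
  have h3 : ∀ s : Λ, π ((Fin.snocEquiv fun _ : Fin (n + 2) => Λ) (s, a) 0) *
      (∏ k : Fin (n + 1), P ((Fin.snocEquiv fun _ : Fin (n + 2) => Λ) (s, a) k.castSucc)
        ((Fin.snocEquiv fun _ : Fin (n + 2) => Λ) (s, a) k.succ)) *
      ψ (Fin.init ((Fin.snocEquiv fun _ : Fin (n + 2) => Λ) (s, a)))
        ((Fin.snocEquiv fun _ : Fin (n + 2) => Λ) (s, a) (Fin.last _)) =
      (π (a 0) * ∏ k : Fin n, P (a k.castSucc) (a k.succ)) *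
        (P (a (Fin.last n)) s * ψ a s) := by
    intro s
    have e0 : (Fin.snocEquiv fun _ : Fin (n + 2) => Λ) (s, a) = Fin.snoc (α := fun _ => Λ) a s :=
      rfl
    rw [e0, Fin.prod_univ_castSucc, ← Fin.castSucc_zero, Fin.init_snoc]
    simp only [Fin.snoc_castSucc, Fin.succ_castSucc, Fin.succ_last, Fin.snoc_last]
    ring
  rw [Finset.sum_congr rfl fun s _ => h3 s, ← Finset.mul_sum, hψ, mul_zero]

theorem IsMarkovChain.integrable_of_dependsOn (hX : IsMarkovChain μ X π P) (n : ℕ)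
    (G : (ℕ → Λ) → ℝ) (hG : ∀ x y : ℕ → Λ, (∀ k ≤ n, x k = y k) → G x = G y) :
    Integrable (fun ω => G fun k => X k ω) μ := by
  have h : (fun ω => G fun k => X k ω) =
      (fun a : Fin (n + 1) → Λ => G fun k => a (Fin.ofNat (n + 1) k)) ∘
        fun ω (k : Fin (n + 1)) => X k ω := by
    ext ω
    refine hG _ _ fun k hk => ?_
    simp [Fin.ofNat, Nat.mod_eq_of_lt (Nat.lt_succ_of_le hk)]
  have hZ : Measurable fun ω (k : Fin (n + 1)) => X k ω :=
    measurable_pi_lambda _ fun k => hX.measurable k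
  have := Measure.isProbabilityMeasure_map (μ := μ) hZ.aemeasurable
  rw [h]
  exact Integrable.comp_measurable Integrable.of_finite hZ

theorem integral_centered_sq_succ (hX : IsMarkovChain μ X π P) {F : ℕ → Λ → ℝ} {B : ℝ}
    (hB : ∀ c s, |F c s| ≤ B) (hF : ∀ c t,
      ∑ s, P t s * (turn c t s + F (c + turn c t s) s) = F c t + Osc π P) (n : ℕ) :
    ∫ ω, centered F (Osc π P) (fun k => X k ω) (n + 1) ^ 2 ∂μ ≤
      ∫ ω, centered F (Osc π P) (fun k => X k ω) n ^ 2 ∂μ + (1 + 2 * B + |Osc π P|) ^ 2 := by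
  let Y : ℕ → Λ → Λ → ℝ := fun c t s =>
    turn c t s + F (c + turn c t s) s - F c t - Osc π P
  have hYb : ∀ c t s, Y c t s ^ 2 ≤ (1 + 2 * B + |Osc π P|) ^ 2 := by
    intro c t s
    refine sq_le_sq.mpr ((abs_le_abs ?_ ?_)) <;>
    · have h1 := abs_le.mp (hB c t)
      have h2 := abs_le.mp (hB (c + turn c t s) s)
      have h3 : (turn c t s : ℝ) ≤ 1 := by exact_mod_cast turn_le_one c t s
      have h4 : (0 : ℝ) ≤ turn c t s := Nat.cast_nonneg _
      have h5 := le_abs_self (Osc π P)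
      have h6 := neg_abs_le (Osc π P)
      simp only [Y]
      linarith
  have hY0 : ∀ c t, ∑ s, P t s * Y c t s = 0 := by
    intro c t
    simp only [Y, mul_sub, Finset.sum_sub_distrib, hF, ← Finset.sum_mul,
      Matrix.sum_row_of_mem_rowStochastic hX.stochastic]
    ring
  have hstep : ∀ x : ℕ → Λ, centered F (Osc π P) x (n + 1) =
      centered F (Osc π P) x n + Y (turnCount x n) (x n) (x (n + 1)) := by
    intro x
    simp only [centered, Y, turnCount_succ]
    push_cast
    ring
  have hYc : ∀ x y : ℕ → Λ, (∀ k ≤ n + 1, x k = y k) →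
      Y (turnCount x n) (x n) (x (n + 1)) = Y (turnCount y n) (y n) (y (n + 1)) := by
    intro x y h
    rw [turnCount_congr fun k hk => h k (by omega), h n (by omega), h (n + 1) le_rfl]
  have hMc : ∀ x y : ℕ → Λ, (∀ k ≤ n + 1, x k = y k) →
      centered F (Osc π P) x n = centered F (Osc π P) y n :=
    fun x y h => centered_congr _ _ fun k hk => h k (by omega)
  have hcross : ∫ ω, centered F (Osc π P) (fun k => X k ω) n *
      Y (turnCount (fun k => X k ω) n) (X n ω) (X (n + 1) ω) ∂μ = 0 := by
    have := hX.integral_eq_zero n (fun a s =>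
      centered F (Osc π P) (fun k => a (Fin.ofNat (n + 1) k)) n *
        Y (turnCount (fun k => a (Fin.ofNat (n + 1) k)) n) (a (Fin.last n)) s) (fun a =>
        (Finset.sum_congr rfl fun s _ => mul_left_comm _ _ _).trans
          (by rw [← Finset.mul_sum, hY0, mul_zero]))
    rw [← this]
    refine integral_congr_ae (Eventually.of_forall fun ω => ?_)
    have hk : ∀ k ≤ n, X k ω = X (Fin.ofNat (n + 1) k) ω := fun k hk => by
      simp [Fin.ofNat, Nat.mod_eq_of_lt (Nat.lt_succ_of_le hk)]
    simp only [Fin.val_last]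
    rw [centered_congr F (Osc π P) (x := fun k => X k ω) hk,
      turnCount_congr (x := fun k => X k ω) hk]
  have hi1 : Integrable (fun ω => centered F (Osc π P) (fun k => X k ω) n ^ 2) μ :=
    hX.integrable_of_dependsOn (n + 1) (fun x => centered F (Osc π P) x n ^ 2)
    fun x y h => by simp only [hMc x y h]
  have hi2 : Integrable
      (fun ω => Y (turnCount (fun k => X k ω) n) (X n ω) (X (n + 1) ω) ^ 2) μ :=
    hX.integrable_of_dependsOn (n + 1)
    (fun x => Y (turnCount x n) (x n) (x (n + 1)) ^ 2) fun x y h => by simp only [hYc x y h]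
  have hi12 : Integrable (fun ω => centered F (Osc π P) (fun k => X k ω) n ^ 2
      + Y (turnCount (fun k => X k ω) n) (X n ω) (X (n + 1) ω) ^ 2) μ := hi1.add hi2
  have hi3 : Integrable (fun ω => centered F (Osc π P) (fun k => X k ω) n *
      Y (turnCount (fun k => X k ω) n) (X n ω) (X (n + 1) ω)) μ :=
    hX.integrable_of_dependsOn (n + 1)
    (fun x => centered F (Osc π P) x n * Y (turnCount x n) (x n) (x (n + 1)))
    fun x y h => by simp only [hMc x y h, hYc x y h]
  calc _ = ∫ ω, (centered F (Osc π P) (fun k => X k ω) n ^ 2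
          + Y (turnCount (fun k => X k ω) n) (X n ω) (X (n + 1) ω) ^ 2
          + 2 * (centered F (Osc π P) (fun k => X k ω) n *
            Y (turnCount (fun k => X k ω) n) (X n ω) (X (n + 1) ω))) ∂μ := by
        refine integral_congr_ae (Eventually.of_forall fun ω => ?_)
        simp only [hstep]
        ring
    _ = ∫ ω, centered F (Osc π P) (fun k => X k ω) n ^ 2 ∂μ
          + ∫ ω, Y (turnCount (fun k => X k ω) n) (X n ω) (X (n + 1) ω) ^ 2 ∂μ := by
        rw [integral_add hi12 (hi3.const_mul 2), integral_add hi1 hi2,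
          integral_const_mul, hcross]
        ring
    _ ≤ _ := by
        gcongr
        calc _ ≤ ∫ _, (1 + 2 * B + |Osc π P|) ^ 2 ∂μ :=
              integral_mono hi2 (integrable_const _) fun ω => hYb _ _ _
          _ = _ := by simp

/-- The variance of the number of turns grows at most linearly. -/
theorem exists_integral_sq_le (hX : IsMarkovChain μ X π P) (hstat : Matrix.vecMul π P = π)
    (hirr : P.IsIrreducible) : ∃ C : ℝ, ∀ n : ℕ,
      ∫ ω, ((turnCount (fun k => X k ω) n : ℝ) - n * Osc π P) ^ 2 ∂μ ≤ C * (n + 1) := by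
  obtain ⟨F, B, hB, hF⟩ := exists_corrector hX.stochastic hX.initial hstat hirr
  set D := (1 + 2 * B + |Osc π P|) ^ 2
  have hFB : ∀ c s, F c s ^ 2 ≤ B ^ 2 := fun c s =>
    sq_le_sq.mpr ((hB c s).trans (le_abs_self B))
  have hi : ∀ n, Integrable (fun ω => centered F (Osc π P) (fun k => X k ω) n ^ 2) μ := fun n =>
    hX.integrable_of_dependsOn n (fun x => centered F (Osc π P) x n ^ 2)
      fun x y h => by simp only [centered_congr F (Osc π P) h]
  have hM : ∀ n : ℕ, ∫ ω, centered F (Osc π P) (fun k => X k ω) n ^ 2 ∂μ ≤ B ^ 2 + n * D := by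
    intro n
    induction n with
    | zero =>
      calc _ ≤ ∫ _, B ^ 2 ∂μ := integral_mono (hi 0) (integrable_const _) fun ω => by
            simpa [centered, turnCount] using hFB 0 (X 0 ω)
        _ = _ := by simp
    | succ n ih =>
      have := integral_centered_sq_succ hX hB hF n
      push_cast
      linarith
  refine ⟨4 * B ^ 2 + 2 * D, fun n => ?_⟩
  have hi' := hX.integrable_of_dependsOn n
    (fun x => ((turnCount x n : ℝ) - n * Osc π P) ^ 2)
    fun x y h => by simp only [turnCount_congr h]
  calc _ ≤ ∫ ω, (2 * centered F (Osc π P) (fun k => X k ω) n ^ 2 + 2 * B ^ 2) ∂μ := by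
        refine integral_mono hi' (((hi n).const_mul 2).add (integrable_const _)) fun ω => ?_
        have h1 := hFB (turnCount (fun k => X k ω) n) (X n ω)
        simp only [centered]
        generalize F (turnCount (fun k => X k ω) n) (X n ω) = u at *
        generalize (turnCount (fun k => X k ω) n : ℝ) = v at *
        -- With `w = v - n * Osc π P`: `2 (w + u)² + 2 u² - w² = (w + 2 u)²`.
        nlinarith [sq_nonneg (v - n * Osc π P + 2 * u)]
    _ = 2 * ∫ ω, centered F (Osc π P) (fun k => X k ω) n ^ 2 ∂μ + 2 * B ^ 2 := by
        rw [integral_add ((hi n).const_mul 2) (integrable_const _), integral_const_mul]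
        simp
    _ ≤ 2 * (B ^ 2 + n * D) + 2 * B ^ 2 := by linarith [hM n]
    _ ≤ (4 * B ^ 2 + 2 * D) * (n + 1) := by
        have hD0 : 0 ≤ D := sq_nonneg _
        nlinarith [sq_nonneg B, mul_nonneg (Nat.cast_nonneg (α := ℝ) n) (sq_nonneg B)]

end Moments

/-! ### Almost sure and mean convergence. -/

section Limit

/-- A sequence whose second moments are summable tends to zero almost surely. -/
theorem ae_tendsto_zero_of_summable_integral_sq {Ω : Type*} [MeasurableSpace Ω] {μ : Measure Ω}
    {Z : ℕ → Ω → ℝ} (hZ : ∀ n, Measurable (Z n)) (hi : ∀ n, Integrable (fun ω => Z n ω ^ 2) μ)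
    (hs : Summable fun n => ∫ ω, Z n ω ^ 2 ∂μ) :
    ∀ᵐ ω ∂μ, Tendsto (fun n => Z n ω) atTop (𝓝 0) := by
  have hm : ∀ n, Measurable fun ω => ENNReal.ofReal (Z n ω ^ 2) := fun n =>
    ((hZ n).pow_const 2).ennreal_ofReal
  have hfin : ∫⁻ ω, ∑' n, ENNReal.ofReal (Z n ω ^ 2) ∂μ ≠ ⊤ := by
    rw [lintegral_tsum fun n => (hm n).aemeasurable]
    simp only [← ofReal_integral_eq_lintegral_ofReal (hi _)
      (Eventually.of_forall fun ω => sq_nonneg _)]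
    exact hs.tsum_ofReal_ne_top
  filter_upwards [ae_lt_top (Measurable.tsum hm) hfin] with ω hω
  have h1 := ENNReal.tendsto_atTop_zero_of_tsum_ne_top hω.ne
  have h2 : Tendsto (fun n => Z n ω ^ 2) atTop (𝓝 0) := by
    have := (ENNReal.tendsto_toReal ENNReal.zero_ne_top).comp h1
    simpa [Function.comp_def, ENNReal.toReal_ofReal (sq_nonneg _)] using this
  have h3 := (Real.continuous_sqrt.tendsto 0).comp h2
  rw [tendsto_zero_iff_abs_tendsto_zero]
  simpa [Function.comp_def, Real.sqrt_sq_eq_abs] using h3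

variable {Λ : Type*} [LinearOrder Λ] [Fintype Λ] [MeasurableSpace Λ] [MeasurableSingletonClass Λ]
  {Ω : Type*} [MeasurableSpace Ω] {μ : Measure Ω} [IsProbabilityMeasure μ]
  {X : ℕ → Ω → Λ} {π : Λ → ℝ} {P : Matrix Λ Λ ℝ}

/-- The mean square error at time `n` is `O(1/n)`, summable along squares; consecutive squares have
ratio tending to 1, so monotonicity suffices in between. -/
theorem ae_tendsto_turnCount_div (hX : IsMarkovChain μ X π P) (hstat : Matrix.vecMul π P = π)
    (hirr : P.IsIrreducible) :
    ∀ᵐ ω ∂μ, Tendsto (fun n : ℕ => (turnCount (fun k => X k ω) n : ℝ) / n) atTop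
      (𝓝 (Osc π P)) := by
  obtain ⟨C, hC⟩ := exists_integral_sq_le hX hstat hirr
  let sq : ℕ → ℕ := fun n => (n + 1) ^ 2
  let Z : ℕ → Ω → ℝ := fun n ω =>
    ((turnCount (fun k => X k ω) (sq n) : ℝ) - (sq n : ℕ) * Osc π P) / (sq n : ℕ)
  have hsq : ∀ n, (0 : ℝ) < (sq n : ℕ) := fun n => by positivity
  have hsq1 : ∀ n, (1 : ℝ) ≤ (sq n : ℕ) := fun n => by
    exact_mod_cast Nat.one_le_pow _ _ n.succ_pos
  have hlim : ∀ᵐ ω ∂μ, Tendsto (fun n => Z n ω) atTop (𝓝 0) := by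
    refine ae_tendsto_zero_of_summable_integral_sq (fun n => ?_) (fun n => ?_) ?_
    · exact hX.measurable_of_dependsOn (sq n)
        (fun x => ((turnCount x (sq n) : ℝ) - (sq n : ℕ) * Osc π P) / (sq n : ℕ))
        fun x y h => by simp only [turnCount_congr h]
    · exact hX.integrable_of_dependsOn (sq n)
        (fun x => (((turnCount x (sq n) : ℝ) - (sq n : ℕ) * Osc π P) / (sq n : ℕ)) ^ 2)
        fun x y h => by simp only [turnCount_congr h]
    · have hC0 : 0 ≤ C := by
        have h0 := (integral_nonneg fun ω => sq_nonneg
          ((turnCount (fun k => X k ω) 0 : ℝ) - (0 : ℕ) * Osc π P)).trans (hC 0)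
        simpa using h0
      -- The factor 2 comes from `N + 1 ≤ 2 N` for `N = sq n ≥ 1`.
      refine Summable.of_nonneg_of_le (fun n => integral_nonneg fun ω => sq_nonneg _)
        (f := fun n : ℕ => 2 * C * (1 / ((n + 1 : ℕ) : ℝ) ^ 2)) (fun n => ?_) ?_
      · simp only [Z, div_pow, integral_div]
        rw [div_le_iff₀ (pow_pos (hsq n) 2)]
        refine (hC (sq n)).trans ?_
        have h1 : (2 : ℝ) * C * (1 / ((n + 1 : ℕ) : ℝ) ^ 2) * ((sq n : ℕ) : ℝ) ^ 2 =
            2 * C * (sq n : ℕ) := by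
          simp only [sq]
          push_cast
          field_simp
        rw [h1]
        nlinarith [hsq1 n]
      · exact ((summable_nat_add_iff 1).mpr
          (Real.summable_one_div_nat_pow.mpr one_lt_two)).mul_left _
  filter_upwards [hlim] with ω hω
  refine tendsto_div_of_monotone_of_exists_subseq_tendsto_div _ _
    (Nat.mono_cast.comp (turnCount_mono _)) fun a ha => ⟨sq, ?_, ?_, ?_⟩
  · have h1 : Tendsto (fun n : ℕ => (1 + 1 / ((n : ℝ) + 1)) ^ 2) atTop (𝓝 ((1 + 0) ^ 2)) :=
      (tendsto_const_nhds.add tendsto_one_div_add_atTop_nhds_zero_nat).pow 2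
    filter_upwards [h1.eventually_lt_const (by simpa using ha)] with n hn
    refine le_trans (le_of_eq ?_) (mul_le_mul_of_nonneg_right hn.le (hsq n).le)
    simp only [sq]
    push_cast
    field_simp
  · exact tendsto_atTop_mono (fun n => by simp only [sq, id]; nlinarith) tendsto_id
  · have := hω.add_const (Osc π P)
    rw [zero_add] at this
    refine this.congr fun n => ?_
    have := (hsq n).ne'
    simp only [Z]
    field_simp
    ring

theorem tendsto_eLpNorm_one_of_bounded {Ω : Type*} [MeasurableSpace Ω] {μ : Measure Ω}
    [IsFiniteMeasure μ] {f : ℕ → Ω → ℝ} {c C : ℝ} (hf : ∀ n, AEStronglyMeasurable (f n) μ)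
    (hb : ∀ n ω, |f n ω - c| ≤ C) (h : ∀ᵐ ω ∂μ, Tendsto (fun n => f n ω) atTop (𝓝 c)) :
    Tendsto (fun n => eLpNorm (fun ω => f n ω - c) 1 μ) atTop (𝓝 0) := by
  simp only [eLpNorm_one_eq_lintegral_enorm, ← ofReal_norm]
  exact tendsto_lintegral_norm_of_dominated_convergence (bound := fun _ => C + |c|) hf
    (integrable_const _).2 (fun n => Eventually.of_forall fun ω => by
      have := abs_sub_abs_le_abs_sub (f n ω) c
      rw [Real.norm_eq_abs]
      linarith [hb n ω]) h

end Limit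

end AlternatingSubsequence

open AlternatingSubsequence in
theorem mainTheorem4
    {Λ : Type*} [LinearOrder Λ] [Fintype Λ] [MeasurableSpace Λ] [MeasurableSingletonClass Λ]
    {Ω : Type*} [MeasurableSpace Ω] (μ : Measure Ω) [IsProbabilityMeasure μ]
    (X : ℕ → Ω → Λ) (π : Λ → ℝ) (P : Matrix Λ Λ ℝ)
    (hX : AlternatingSubsequence.IsMarkovChain μ X π P)
    (hstat : Matrix.vecMul π P = π)
    (hirr : P.IsIrreducible) :
    (∀ᵐ ω ∂μ, Tendsto
      (fun n : ℕ =>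
        (AlternatingSubsequence.LA (fun k : Fin (n + 1) => X k ω) : ℝ) / (n : ℝ))
      atTop (𝓝 (AlternatingSubsequence.Osc π P))) ∧
    Tendsto
      (fun n : ℕ => eLpNorm
        (fun ω => (AlternatingSubsequence.LA (fun k : Fin (n + 1) => X k ω) : ℝ) / (n : ℝ)
          - AlternatingSubsequence.Osc π P) 1 μ)
      atTop (𝓝 0) := by
  have hLA : ∀ (n : ℕ) (ω : Ω), (LA (fun k : Fin (n + 1) => X k ω) : ℝ) =
      turnCount (fun k => X k ω) n + 1 := fun n ω => by
    rw [LA_eq_turnCount_add_one (fun k => X k ω) n]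
    push_cast
    rfl
  simp only [hLA]
  have hae : ∀ᵐ ω ∂μ, Tendsto (fun n : ℕ => ((turnCount (fun k => X k ω) n : ℝ) + 1) / n) atTop
      (𝓝 (Osc π P)) := by
    filter_upwards [ae_tendsto_turnCount_div hX hstat hirr] with ω hω
    simpa [add_div] using hω.add tendsto_one_div_atTop_nhds_zero_nat
  -- At most `n` turns occur, so the quotient is at most 2; at `n = 0` it is 0 by convention.
  refine ⟨hae, tendsto_eLpNorm_one_of_bounded (C := 2 + |Osc π P|) (fun n => ?_)
    (fun n ω => ?_) hae⟩
  · exact (hX.measurable_of_dependsOn n (fun x => ((turnCount x n : ℝ) + 1) / n)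
      fun x y h => by simp only [turnCount_congr h]).aestronglyMeasurable
  · refine (abs_sub _ _).trans (add_le_add_left ?_ _)
    rw [abs_of_nonneg (by positivity)]
    rcases Nat.eq_zero_or_pos n with rfl | hn
    · simp
    · rw [div_le_iff₀ (by exact_mod_cast hn)]
      have h1 : (turnCount (fun k => X k ω) n : ℝ) ≤ n := by exact_mod_cast turnCount_le _ n
      have h2 : (1 : ℝ) ≤ n := by exact_mod_cast hn
      linarith
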